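/- Conventions. For a bicategory $\mathscr K$, $\mathscr K^{\mathrm{op}}$ reverses the 1-cells and $\mathscr K^{\mathrm{co}}$ the 2-cells of $\mathscr K$. The slice (comma object) of a cospan $A\xrightarrow{f}C\xleftarrow{g}B$ in $\mathscr K$ is an object $f\downarrow g$ with $s: f\downarrow g\to A$, $t: f\downarrow g\to B$ and a 2-cell $\lambda : f\circ s\Rightarrow g\circ t$ such that pasting with $\lambda$ gives, for every object $X$, an equivalence from $\mathscr K(X,f\downarrow g)$ to the comma category $\mathscr K(X,f)\downarrow\mathscr K(X,g)$; a bipullback is defined in the same way with $\lambda$ invertible and with the pseudopullback (iso-comma category) in place of the comma category. A bipushout in $\mathscr K$ is a bipullback in $\mathscr K^{\mathrm{op}}$. Write $E\downarrow E$ for $1_E\downarrow 1_E$ and $A\downarrow p$ for $1_A\downarrow p$. A morphism $p:E\to A$ is a fibration when the morphism $\bar p:E\downarrow E\to A\downarrow p$ induced by $p$ has a right adjoint with invertible counit (if $\mathscr K$ lacks these slices, the condition is imposed on the image of $p$ under the bicategorical Yoneda embedding $\mathscr K\to\mathrm{Hom}(\mathscr K^{\mathrm{op}},\mathrm{Cat})$).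 A cofibration in $\mathscr K$ is a fibration in $\mathscr K^{\mathrm{op}}$, and a coopfibration in $\mathscr K$ is a fibration in $\mathscr K^{\mathrm{coop}}$. A pseudofunctor $T:\mathscr K\to\mathscr X$ between bicategories is homodular when (H1) for every cofibration $i$ in $\mathscr K$, the morphism $Ti$ has a right adjoint $Ti^*$; and (H2) for every bipushout square in $\mathscr K$, with $i:A\to X$ a cofibration, $j:A\to Y$ a coopfibration, $h:X\to Q$, $k:Y\to Q$ and invertible 2-cell $k\circ j\cong h\circ i$, the morphism $Tk$ has a right adjoint $Tk^*$ and the mate $Tj\circ Ti^*\Rightarrow Tk^*\circ Th$ of the image under $T$ of the invertible 2-cell is invertible. Let $\mathrm{Cat}$ be the 2-category of small categories, functors and natural transformations. Let $\mathrm{Mod}$ be the bicategory whose objects are small categories, with $\mathrm{Mod}(B,A)$ the category of functors $A^{\mathrm{op}}\times B\to\mathrm{Set}$, with composition $(m\circ n)(a,c)=\int^{b} n(b,c)\times m(a,b)$ and with the hom functors as identities. Let $(-)^*:\mathrm{Cat}^{\mathrm{op}}\to\mathrm{Mod}^{\mathrm{co}}$ be the pseudofunctor which is the identity on objects, takes a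 functor $f:B\to A$ to the module $f^*:A\to B$, $f^*(b,a)=A(fb,a)$, and takes a natural transformation $\sigma:f\Rightarrow g$ to the morphism $g^*\Rightarrow f^*$ given by precomposition with the components of $\sigma$. **Theorem.** The pseudofunctor $(-)^*:\mathrm{Cat}^{\mathrm{op}}\to\mathrm{Mod}^{\mathrm{co}}$ is homodular. -/

import Mathlib

open CategoryTheory Bicategory Opposite Limits

universe w v u w₁ v₁ u₁ w₂ v₂ u₂

/-- The bicategory `K^co`, with the `2`-cells of `K` reversed. -/
structure Co (K : Type u) where
  /-- The underlying object of `K`. -/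
  unco : K

namespace Co

variable {K : Type u} [Bicategory.{w, v} K]

/-- A `1`-cell of `K^co` is a `1`-cell of `K`. -/
structure Hom (a b : Co K) where
  /-- The underlying `1`-cell of `K`. -/
  unco : a.unco ⟶ b.unco

instance : CategoryStruct.{v} (Co K) where
  Hom a b := Hom a b
  id a := ⟨𝟙 a.unco⟩
  comp f g := ⟨f.unco ≫ g.unco⟩

/-- A `2`-cell `f ⟶ g` of `K^co` is a `2`-cell `g ⟶ f` of `K`. -/
structure Hom₂ {a b : Co K} (f g : a ⟶ b) where
  /-- The underlying `2`-cell of `K`. -/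
  unco₂ : g.unco ⟶ f.unco

instance homCategory (a b : Co K) : Category.{w} (a ⟶ b) where
  Hom f g := Hom₂ f g
  id f := ⟨𝟙 f.unco⟩
  comp η θ := ⟨θ.unco₂ ≫ η.unco₂⟩
  id_comp η := congrArg Hom₂.mk (Category.comp_id η.unco₂)
  comp_id η := congrArg Hom₂.mk (Category.id_comp η.unco₂)
  assoc η θ ι := congrArg Hom₂.mk (Category.assoc ι.unco₂ θ.unco₂ η.unco₂).symm

@[simp] theorem id_unco (a : Co K) : (𝟙 a : a ⟶ a).unco = 𝟙 a.unco := rfl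

@[simp] theorem comp_unco {a b c : Co K} (f : a ⟶ b) (g : b ⟶ c) :
    (f ≫ g).unco = f.unco ≫ g.unco := rfl

@[simp] theorem id_unco₂ {a b : Co K} (f : a ⟶ b) : (𝟙 f : f ⟶ f).unco₂ = 𝟙 f.unco := rfl

@[simp] theorem comp_unco₂ {a b : Co K} {f g h : a ⟶ b} (η : f ⟶ g) (θ : g ⟶ h) :
    (η ≫ θ).unco₂ = θ.unco₂ ≫ η.unco₂ := rfl

/-- The `1`-cell of `K^co` given by a `1`-cell of `K`. -/
def hom {a b : K} (f : a ⟶ b) : (⟨a⟩ : Co K) ⟶ ⟨b⟩ :=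
  ⟨f⟩

/-- An isomorphism of `1`-cells of `K` gives one in `K^co`. -/
def iso {a b : Co K} {f g : a ⟶ b} (e : f.unco ≅ g.unco) : f ≅ g where
  hom := ⟨e.inv⟩
  inv := ⟨e.hom⟩
  hom_inv_id := congrArg Hom₂.mk e.hom_inv_id
  inv_hom_id := congrArg Hom₂.mk e.inv_hom_id

instance bicategory : Bicategory.{w, v} (Co K) where
  homCategory := homCategory
  whiskerLeft f _ _ η := ⟨f.unco ◁ η.unco₂⟩
  whiskerRight η h := ⟨η.unco₂ ▷ h.unco⟩
  associator f g h := iso (α_ f.unco g.unco h.unco)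
  leftUnitor f := iso (λ_ f.unco)
  rightUnitor f := iso (ρ_ f.unco)
  whiskerLeft_id f g := congrArg Hom₂.mk (whiskerLeft_id f.unco g.unco)
  whiskerLeft_comp f _ _ _ η θ := congrArg Hom₂.mk (whiskerLeft_comp f.unco θ.unco₂ η.unco₂)
  id_whiskerLeft η := congrArg Hom₂.mk (by simp [iso])
  comp_whiskerLeft f g _ _ η := congrArg Hom₂.mk (by simp [iso])
  id_whiskerRight f g := congrArg Hom₂.mk (id_whiskerRight f.unco g.unco)
  comp_whiskerRight η θ i := congrArg Hom₂.mk (comp_whiskerRight θ.unco₂ η.unco₂ i.unco)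
  whiskerRight_id η := congrArg Hom₂.mk (by simp [iso])
  whiskerRight_comp η g h := congrArg Hom₂.mk (by simp [iso])
  whisker_assoc f _ _ η h := congrArg Hom₂.mk (by simp [iso])
  whisker_exchange η θ := congrArg Hom₂.mk (whisker_exchange η.unco₂ θ.unco₂).symm
  pentagon f g h i := congrArg Hom₂.mk (by simp [iso])
  triangle f g := congrArg Hom₂.mk (by simp [iso])

end Co

section Slices

variable {K : Type u} [Bicategory.{w, v} K] {A B C : K}

/-- Pasting with a `2`-cell `lam : f ∘ s ⟶ g ∘ t` gives a functor from `K(X, S)` to the comma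
category of `K(X, f)` and `K(X, g)`. -/
def sliceFunctor {f : A ⟶ C} {g : B ⟶ C} {S : K} {s : S ⟶ A} {t : S ⟶ B}
    (lam : s ≫ f ⟶ t ≫ g) (X : K) : (X ⟶ S) ⥤ Comma (postcomp X f) (postcomp X g) where
  obj h :=
    { left := h ≫ s
      right := h ≫ t
      hom := (α_ h s f).hom ≫ h ◁ lam ≫ (α_ h t g).inv }
  map {h h'} η :=
    { left := η ▷ s
      right := η ▷ t
      w := by
        change η ▷ s ▷ f ≫ (α_ h' s f).hom ≫ h' ◁ lam ≫ (α_ h' t g).inv =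
          ((α_ h s f).hom ≫ h ◁ lam ≫ (α_ h t g).inv) ≫ η ▷ t ▷ g
        rw [associator_naturality_left_assoc, ← whisker_exchange_assoc,
          associator_inv_naturality_left, Category.assoc, Category.assoc] }

/-- A slice (comma object) of `f : A ⟶ C` over `g : B ⟶ C`. -/
structure Slice (f : A ⟶ C) (g : B ⟶ C) where
  /-- The vertex. -/
  pt : K
  /-- The first projection. -/
  s : pt ⟶ A
  /-- The second projection. -/
  t : pt ⟶ B
  /-- The `2`-cell `f ∘ s ⟶ g ∘ t`. -/
  lam : s ≫ f ⟶ t ≫ g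
  isEquivalence (X : K) : (sliceFunctor lam X).IsEquivalence

/-- Pasting with an invertible `2`-cell `θ : f ∘ s ≅ g ∘ t` gives a functor from `K(X, P)` to the
pseudopullback of `K(X, f)` and `K(X, g)`. -/
def bipullbackFunctor {f : A ⟶ C} {g : B ⟶ C} {P : K} {s : P ⟶ A} {t : P ⟶ B}
    (θ : s ≫ f ≅ t ≫ g) (X : K) :
    (X ⟶ P) ⥤ CategoricalPullback (postcomp X f) (postcomp X g) where
  obj h :=
    { fst := h ≫ s
      snd := h ≫ t
      iso := α_ h s f ≪≫ whiskerLeftIso h θ ≪≫ (α_ h t g).symm }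
  map {h h'} η :=
    { fst := η ▷ s
      snd := η ▷ t
      w := by
        change η ▷ s ▷ f ≫ (α_ h' s f).hom ≫ h' ◁ θ.hom ≫ (α_ h' t g).inv =
          ((α_ h s f).hom ≫ h ◁ θ.hom ≫ (α_ h t g).inv) ≫ η ▷ t ▷ g
        rw [associator_naturality_left_assoc, ← whisker_exchange_assoc,
          associator_inv_naturality_left, Category.assoc, Category.assoc] }

/-- The square with invertible `2`-cell `θ` is a bipullback. -/
def IsBipullback {f : A ⟶ C} {g : B ⟶ C} {P : K} {s : P ⟶ A} {t : P ⟶ B}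
    (θ : s ≫ f ≅ t ≫ g) : Prop :=
  ∀ X : K, (bipullbackFunctor θ X).IsEquivalence

/-- The square with invertible `2`-cell `θ : k ∘ j ≅ h ∘ i` is a bipushout in `K`, that is, a
bipullback in `Kᵒᵖ`. -/
def IsBipushout {X Y Q : K} {i : A ⟶ X} {j : A ⟶ Y} {h : X ⟶ Q} {k : Y ⟶ Q}
    (θ : j ≫ k ≅ i ≫ h) : Prop :=
  IsBipullback (f := j.op) (g := i.op) (s := k.op) (t := h.op) θ.op2

end Slices

section Fibrations

variable {K : Type u} [Bicategory.{w, v} K]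

/-- The condition for `p` to be a fibration, stated through slices: the slices `E ↓ E` and `A ↓ p` exist, and the morphism `pbar : E ↓ E ⟶ A ↓ p` induced by
`p : E ⟶ A` has a right adjoint with invertible counit. -/
def IsSliceFibration {E A : K} (p : E ⟶ A) : Prop :=
  ∃ (S₀ : Slice (𝟙 E) (𝟙 E)) (S₁ : Slice (𝟙 A) p) (pbar : S₀.pt ⟶ S₁.pt)
    (σ : S₀.s ≫ p ≅ pbar ≫ S₁.s) (τ : pbar ≫ S₁.t ≅ S₀.t),
    σ.hom ≫ pbar ◁ ((ρ_ S₁.s).inv ≫ S₁.lam) ≫ (α_ pbar S₁.t p).inv ≫ τ.hom ▷ p =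
        ((ρ_ S₀.s).inv ≫ S₀.lam ≫ (ρ_ S₀.t).hom) ▷ p ∧
      ∃ (r : S₁.pt ⟶ S₀.pt) (adj : pbar ⊣ r), IsIso adj.counit

open scoped Pseudofunctor.StrongTrans in
/-- Fibrations in a bicategory. When the slices `E ↓ E` and `A ↓ p` do not exist in `K`, the
condition is imposed on the image of `p` under the bicategorical Yoneda embedding. -/
def IsFibration {E A : K} (p : E ⟶ A) : Prop :=
  IsSliceFibration p ∨
    (¬ (Nonempty (Slice (𝟙 E) (𝟙 E)) ∧ Nonempty (Slice (𝟙 A) p)) ∧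
      IsSliceFibration ((Bicategory.yoneda (B := K)).map p))

/-- A cofibration in `K` is a fibration in `Kᵒᵖ`. -/
def IsCofibration {A X : K} (i : A ⟶ X) : Prop :=
  IsFibration i.op

/-- A coopfibration in `K` is a fibration in `K^coop`. -/
def IsCoopfibration {A Y : K} (j : A ⟶ Y) : Prop :=
  IsFibration (K := Co Kᵒᵖ) (E := ⟨op Y⟩) (A := ⟨op A⟩) (Co.hom j.op)

end Fibrations

section Homodular

variable {K : Type u₁} [Bicategory.{w₁, v₁} K] {X : Type u₂} [Bicategory.{w₂, v₂} X]

/-- The image under a pseudofunctor of the `2`-cell of a square. -/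
def mapSquare (T : K ⥤ᵖ X) {A B C D : K} {i : A ⟶ B} {j : A ⟶ C} {h : B ⟶ D} {k : C ⟶ D}
    (θ : j ≫ k ⟶ i ≫ h) : T.map j ≫ T.map k ⟶ T.map i ≫ T.map h :=
  (T.mapComp j k).inv ≫ T.map₂ θ ≫ (T.mapComp i h).hom

/-- Homodular pseudofunctors. The mate of `Tk ∘ Tj ⟶ Th ∘ Ti` is a `2`-cell
`Tj ∘ (Ti)^* ⟶ (Tk)^* ∘ Th`. -/
structure IsHomodular (T : K ⥤ᵖ X) : Prop where
  isLeftAdjoint {A B : K} (i : A ⟶ B) (hi : IsCofibration i) : IsLeftAdjoint (T.map i)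
  isIso_mate {A B C D : K} {i : A ⟶ B} {j : A ⟶ C} {h : B ⟶ D} {k : C ⟶ D}
    (θ : j ≫ k ≅ i ≫ h) (hθ : IsBipushout θ) (hi : IsCofibration i) (hj : IsCoopfibration j) :
    IsLeftAdjoint (T.map k) ∧
      ∀ (ri : T.obj B ⟶ T.obj A) (adji : T.map i ⊣ ri) (rk : T.obj D ⟶ T.obj C)
        (adjk : T.map k ⊣ rk), IsIso (mateEquiv adji adjk (mapSquare T θ.hom))

end Homodular

namespace SetMod

section Composition

variable {A B C D : Type u} [Category.{u} A] [Category.{u} B] [Category.{u} C] [Category.{u} D]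

/-- The integrand `(b', b) ↦ n(b', c) × m(a, b)`. -/
@[simps]
def integrand (n : Profunctor.{u} C B) (m : Profunctor.{u} B A) (c : C) (a : Aᵒᵖ) :
    Bᵒᵖ ⥤ B ⥤ Type u where
  obj b' :=
    { obj := fun b => (n.obj c).obj b' × (m.obj b).obj a
      map := fun g => ↾fun x => (x.1, (m.map g).app a x.2) }
  map f := { app := fun b => ↾fun x => ((n.obj c).map f x.1, x.2) }

/-- The coend `∫^b n(b, c) × m(a, b)`. -/
abbrev Comp (n : Profunctor.{u} C B) (m : Profunctor.{u} B A) (c : C) (a : Aᵒᵖ) : Type u :=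
  Types.coend.{u} (integrand n m c a)

namespace Comp

variable {n : Profunctor.{u} C B} {m : Profunctor.{u} B A} {c : C} {a : Aᵒᵖ}

/-- The class `[b, x, y]`. -/
def mk (b : B) (x : (n.obj c).obj (op b)) (y : (m.obj b).obj a) : Comp n m c a :=
  Quot.mk _ ⟨b, (x, y)⟩

theorem sound {b b' : B} (f : b ⟶ b') (x : (n.obj c).obj (op b')) (y : (m.obj b).obj a) :
    (mk b ((n.obj c).map f.op x) y : Comp n m c a) = mk b' x ((m.map f).app a y) :=
  Quot.sound (Types.coendRel.mk (F := integrand n m c a) f (x, y))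

theorem ind {P : Comp n m c a → Prop} (h : ∀ b x y, P (mk b x y)) (z : Comp n m c a) : P z := by
  obtain ⟨b, x, y⟩ := z
  exact h b x y

/-- Maps out of the coend. -/
def lift {T : Type*} (φ : ∀ b, (n.obj c).obj (op b) → (m.obj b).obj a → T)
    (h : ∀ {b b' : B} (f : b ⟶ b') (x : (n.obj c).obj (op b')) (y : (m.obj b).obj a),
      φ b ((n.obj c).map f.op x) y = φ b' x ((m.map f).app a y)) (z : Comp n m c a) : T :=
  Quot.lift (fun z => φ z.1 z.2.1 z.2.2) (by rintro _ _ ⟨f, x⟩; exact h f x.1 x.2) z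

@[simp]
theorem lift_mk {T : Type*} (φ : ∀ b, (n.obj c).obj (op b) → (m.obj b).obj a → T) (h)
    (b : B) (x : (n.obj c).obj (op b)) (y : (m.obj b).obj a) :
    lift φ h (mk b x y : Comp n m c a) = φ b x y := rfl

end Comp

/-- The composite module `m ∘ n`, with `(m ∘ n)(a, c) = ∫^b n(b, c) × m(a, b)`. -/
@[simps! obj_obj]
def comp (n : Profunctor.{u} C B) (m : Profunctor.{u} B A) : Profunctor.{u} C A where
  obj c :=
    { obj := fun a => Comp n m c a
      map := fun g => ↾Comp.lift (fun b x y => Comp.mk b x ((m.obj b).map g y))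
        (fun f x y => by simp [Comp.sound])
      map_id := fun a => by ext z; induction z using Comp.ind; simp
      map_comp := fun f g => by ext z; induction z using Comp.ind; simp }
  map h :=
    { app := fun a => ↾Comp.lift (fun b x y => Comp.mk b ((n.map h).app (op b) x) y)
        (fun f x y => by simp [← Comp.sound])
      naturality := fun a a' g => by ext z; induction z using Comp.ind; simp }
  map_id c := by ext a z; induction z using Comp.ind; simp
  map_comp f g := by ext a z; induction z using Comp.ind; simp


section

variable {n : Profunctor.{u} C B} {m : Profunctor.{u} B A}

@[simp]
theorem comp_obj_map_mk {c : C} {a a' : Aᵒᵖ} (g : a ⟶ a') (b : B) (x : (n.obj c).obj (op b))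
    (y : (m.obj b).obj a) :
    ((comp n m).obj c).map g (Comp.mk b x y) = Comp.mk b x ((m.obj b).map g y) := rfl

@[simp]
theorem comp_map_app_mk {c c' : C} (h : c ⟶ c') {a : Aᵒᵖ} (b : B) (x : (n.obj c).obj (op b))
    (y : (m.obj b).obj a) :
    ((comp n m).map h).app a (Comp.mk b x y) = Comp.mk b ((n.map h).app (op b) x) y := rfl

end

theorem comp_hom_ext₁ {n : Profunctor.{u} C B} {m : Profunctor.{u} B A} {c : C} {a : Aᵒᵖ}
    {T : Type u} {σ τ : ((comp n m).obj c).obj a ⟶ T}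
    (h : ∀ b x y, σ (Comp.mk b x y) = τ (Comp.mk b x y)) : σ = τ :=
  ConcreteCategory.hom_ext _ _ fun z => Comp.ind (P := fun z => σ z = τ z) h z

theorem comp_hom_ext₂ {n : Profunctor.{u} C B} {m : Profunctor.{u} B A} {c : C}
    {k : Aᵒᵖ ⥤ Type u} {σ τ : (comp n m).obj c ⟶ k}
    (h : ∀ a b x y, σ.app a (Comp.mk b x y) = τ.app a (Comp.mk b x y)) : σ = τ :=
  NatTrans.ext (funext fun a => comp_hom_ext₁ (h a))

theorem comp_hom_ext {n : Profunctor.{u} C B} {m : Profunctor.{u} B A} {k : Profunctor.{u} C A}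
    {σ τ : comp n m ⟶ k}
    (h : ∀ c a b x y, (σ.app c).app a (Comp.mk b x y) = (τ.app c).app a (Comp.mk b x y)) :
    σ = τ :=
  NatTrans.ext (funext fun c => comp_hom_ext₂ (h c))

section

variable {m m' : Profunctor.{u} B A} (τ : m ⟶ m')

theorem app_map {b : B} {a a' : Aᵒᵖ} (g : a ⟶ a') (x : (m.obj b).obj a) :
    (τ.app b).app a' ((m.obj b).map g x) = (m'.obj b).map g ((τ.app b).app a x) :=
  NatTrans.naturality_apply (τ.app b) g x

theorem app_map_app {b b' : B} (f : b ⟶ b') {a : Aᵒᵖ} (x : (m.obj b).obj a) :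
    (τ.app b').app a ((m.map f).app a x) = (m'.map f).app a ((τ.app b).app a x) :=
  types_congr_hom (NatTrans.congr_app (τ.naturality f) a) x

theorem map_app_map {b b' : B} (f : b ⟶ b') {a a' : Aᵒᵖ} (g : a ⟶ a') (x : (m.obj b).obj a) :
    (m.map f).app a' ((m.obj b).map g x) = (m.obj b').map g ((m.map f).app a x) :=
  NatTrans.naturality_apply (m.map f) g x

theorem map_comp_app {b b' b'' : B} (f : b ⟶ b') (g : b' ⟶ b'') {a : Aᵒᵖ} (x : (m.obj b).obj a) :
    (m.map (f ≫ g)).app a x = (m.map g).app a ((m.map f).app a x) :=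
  types_congr_hom (NatTrans.congr_app (m.map_comp f g) a) x

theorem obj_map_comp {b : B} {a a' a'' : Aᵒᵖ} (f : a ⟶ a') (g : a' ⟶ a'') (x : (m.obj b).obj a) :
    (m.obj b).map (f ≫ g) x = (m.obj b).map g ((m.obj b).map f x) :=
  types_congr_hom ((m.obj b).map_comp f g) x

end

/-- Horizontal composition of morphisms of modules. -/
def compMap {n n' : Profunctor.{u} C B} {m m' : Profunctor.{u} B A} (σ : n ⟶ n') (τ : m ⟶ m') :
    comp n m ⟶ comp n' m' where
  app c :=
    { app := fun a => ↾Comp.lift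
        (fun b x y => (Comp.mk b ((σ.app c).app (op b) x) ((τ.app b).app a y) : Comp n' m' c a))
        (fun f x y =>
          (congrArg (fun t => Comp.mk _ t _) (app_map σ f.op x)).trans
            ((Comp.sound f _ _).trans (congrArg (Comp.mk _ _) (app_map_app τ f y).symm)))
      naturality := fun _ _ g => comp_hom_ext₁ fun b _ y =>
        congrArg (Comp.mk b _) (app_map τ g y) }
  naturality _ _ h := comp_hom_ext₂ fun _ b x _ =>
    congrArg (fun t => Comp.mk b t _) (app_map_app σ h x)

@[simp]
theorem compMap_app_mk {n n' : Profunctor.{u} C B} {m m' : Profunctor.{u} B A} (σ : n ⟶ n')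
    (τ : m ⟶ m') (c : C) (a : Aᵒᵖ) (b : B) (x : (n.obj c).obj (op b)) (y : (m.obj b).obj a) :
    ((compMap σ τ).app c).app a (Comp.mk b x y) =
      Comp.mk b ((σ.app c).app (op b) x) ((τ.app b).app a y) := rfl

/-- An isomorphism of modules from inverse bijections. -/
def isoMk {m m' : Profunctor.{u} B A} (σ : m ⟶ m') (τ : m' ⟶ m)
    (h₁ : ∀ b a x, (τ.app b).app a ((σ.app b).app a x) = x)
    (h₂ : ∀ b a x, (σ.app b).app a ((τ.app b).app a x) = x) : m ≅ m' where
  hom := σ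
  inv := τ
  hom_inv_id := by ext b a x; exact h₁ b a x
  inv_hom_id := by ext b a x; exact h₂ b a x

/-- `[b, [c, x, z], y] ↦ [c, x, [b, z, y]]`. -/
def assocHom (p : Profunctor.{u} D C) (n : Profunctor.{u} C B) (m : Profunctor.{u} B A) :
    comp (comp p n) m ⟶ comp p (comp n m) where
  app d :=
    { app := fun a => ↾Comp.lift
        (fun b w y => Comp.lift
          (fun c x z => (Comp.mk c x (Comp.mk b z y) : Comp p (comp n m) d a))
          (fun f x z => Comp.sound (m := comp n m) f x (Comp.mk b z y)) w)
        (fun {b b'} f w y => by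
          induction w using Comp.ind with | _ c x z => _
          exact congrArg (Comp.mk c x) (Comp.sound f z y))
      naturality := fun a a' g => by
        refine ConcreteCategory.hom_ext _ _ fun z => ?_
        induction z using Comp.ind with | _ b w y => _
        induction w using Comp.ind with | _ c x z => _
        rfl }
  naturality d d' h := by
    refine comp_hom_ext₂ fun a b w y => ?_
    induction w using Comp.ind with | _ c x z => _
    rfl

/-- `[c, x, [b, z, y]] ↦ [b, [c, x, z], y]`. -/
def assocInv (p : Profunctor.{u} D C) (n : Profunctor.{u} C B) (m : Profunctor.{u} B A) :
    comp p (comp n m) ⟶ comp (comp p n) m where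
  app d :=
    { app := fun a => ↾Comp.lift
        (fun c x w => Comp.lift
          (fun b z y => (Comp.mk b (Comp.mk c x z) y : Comp (comp p n) m d a))
          (fun f z y => Comp.sound (n := comp p n) f (Comp.mk c x z) y) w)
        (fun {c c'} f x w => by
          induction w using Comp.ind with | _ b z y => _
          exact congrArg (fun t => Comp.mk b t y) (Comp.sound f x z))
      naturality := fun a a' g => by
        refine ConcreteCategory.hom_ext _ _ fun z => ?_
        induction z using Comp.ind with | _ c x w => _
        induction w using Comp.ind with | _ b z y => _
        rfl }
  naturality d d' h := by
    refine comp_hom_ext₂ fun a c x w => ?_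
    induction w using Comp.ind with | _ b z y => _
    rfl

/-- The associativity constraint for composition of modules. -/
def assoc (p : Profunctor.{u} D C) (n : Profunctor.{u} C B) (m : Profunctor.{u} B A) :
    comp (comp p n) m ≅ comp p (comp n m) :=
  isoMk (assocHom p n m) (assocInv p n m)
    (fun d a t => by
      induction t using Comp.ind with | _ b w y => _
      induction w using Comp.ind with | _ c x z => _
      rfl)
    (fun d a t => by
      induction t using Comp.ind with | _ c x w => _
      induction w using Comp.ind with | _ b z y => _
      rfl)

/-- The unit constraint `[b', f, y] ↦ m(f) y`. -/
def leftUnit (m : Profunctor.{u} B A) : comp (Profunctor.id (C := B)) m ≅ m :=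
  isoMk
    { app := fun b =>
        { app := fun a => ↾Comp.lift (fun b' (f : b' ⟶ b) y => (m.map f).app a y)
            (fun f x y => by
              exact map_comp_app f x y)
          naturality := fun a a' g => by
            refine ConcreteCategory.hom_ext _ _ fun z => ?_
            induction z using Comp.ind with | _ b' f y => _
            exact map_app_map f g y }
      naturality := fun b₁ b₂ h => comp_hom_ext₂ fun a b' f y => map_comp_app f h y }
    { app := fun b =>
        { app := fun a => ↾fun y => (Comp.mk b (𝟙 b) y : Comp (Profunctor.id (C := B)) m b a)
          naturality := fun a a' g => rfl }
      naturality := fun b₁ b₂ h => by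
        ext a y
        change (Comp.mk b₂ (𝟙 b₂) ((m.map h).app a y) : Comp (Profunctor.id (C := B)) m b₂ a) =
          Comp.mk b₁ (𝟙 b₁ ≫ h) y
        refine (Comp.sound (n := Profunctor.id (C := B)) h (𝟙 b₂) y).symm.trans ?_
        refine congrArg (fun t => Comp.mk b₁ t y) ?_
        exact (Category.comp_id h).trans (Category.id_comp h).symm }
    (fun b a z => by
      induction z using Comp.ind with | _ b' f y => _
      change (Comp.mk b (𝟙 b) ((m.map f).app a y) : Comp (Profunctor.id (C := B)) m b a) =
          Comp.mk b' f y
      refine (Comp.sound (n := Profunctor.id (C := B)) f (𝟙 b) y).symm.trans ?_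
      exact congrArg (fun t => Comp.mk b' t y) (Category.comp_id f))
    (fun b a y => by
      change (m.map (𝟙 b)).app a y = y
      simp)

/-- The unit constraint `[a', x, f] ↦ m(f) x`. -/
def rightUnit (m : Profunctor.{u} B A) : comp m (Profunctor.id (C := A)) ≅ m :=
  isoMk
    { app := fun b =>
        { app := fun a => ↾Comp.lift (fun a' x (f : a.unop ⟶ a') => (m.obj b).map f.op x)
            (fun f x y => (obj_map_comp f.op (Quiver.Hom.op y) x).symm)
          naturality := fun a a' g => by
            refine ConcreteCategory.hom_ext _ _ fun z => ?_
            induction z using Comp.ind with | _ c x f => _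
            exact obj_map_comp (Quiver.Hom.op f) g x }
      naturality := fun b₁ b₂ h => comp_hom_ext₂ fun a a' x f =>
        (map_app_map h (Quiver.Hom.op f) x).symm }
    { app := fun b =>
        { app := fun a => ↾fun x =>
            (Comp.mk a.unop x (𝟙 a.unop) : Comp m (Profunctor.id (C := A)) b a)
          naturality := fun a a' g => by
            refine ConcreteCategory.hom_ext _ _ fun x => ?_
            change (Comp.mk a'.unop ((m.obj b).map g x) (𝟙 a'.unop) :
              Comp m (Profunctor.id (C := A)) b a') = Comp.mk a.unop x (g.unop ≫ 𝟙 a.unop)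
            refine (Comp.sound (m := Profunctor.id (C := A)) g.unop x (𝟙 a'.unop)).trans ?_
            refine congrArg (Comp.mk a.unop x) ?_
            exact (Category.id_comp g.unop).trans (Category.comp_id g.unop).symm }
      naturality := fun b₁ b₂ h => rfl }
    (fun b a z => by
      induction z using Comp.ind with | _ a' x f => _
      change (Comp.mk a.unop ((m.obj b).map f.op x) (𝟙 a.unop) :
        Comp m (Profunctor.id (C := A)) b a) = Comp.mk a' x f
      refine (Comp.sound (m := Profunctor.id (C := A)) f x (𝟙 a.unop)).trans ?_
      exact congrArg (Comp.mk a' x) (Category.id_comp f))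
    (fun b a x => by
      change (m.obj b).map (𝟙 a) x = x
      simp)

end Composition

end SetMod

/-- The bicategory of small categories and modules between them: a `1`-cell `B ⟶ A` is a functor
`m : B ⥤ Aᵒᵖ ⥤ Type u`, its value `m(a, b)` being `(m.obj b).obj (op a)`. -/
structure SetMod where
  /-- The underlying small category. -/
  cat : Cat.{u, u}

namespace SetMod

/-- Composition is by coends, and the identity of `A` is the hom functor of `A`. -/
instance : CategoryStruct SetMod.{u} where
  Hom B A := Profunctor.{u} B.cat A.cat
  id A := Profunctor.id (C := A.cat)
  comp n m := comp n m

instance homCategory (B A : SetMod.{u}) : Category (B ⟶ A) :=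
  inferInstanceAs (Category (B.cat ⥤ (A.cat)ᵒᵖ ⥤ Type u))

theorem hom₂_ext {B A : SetMod.{u}} {m m' : B ⟶ A} {σ τ : m ⟶ m'}
    (h : ∀ b a x, (NatTrans.app (NatTrans.app σ b) a) x = (NatTrans.app (NatTrans.app τ b) a) x) :
    σ = τ := by
  refine NatTrans.ext (funext fun b => NatTrans.ext (funext fun a => ?_))
  exact ConcreteCategory.hom_ext _ _ (h b a)

instance bicategory : Bicategory SetMod.{u} where
  homCategory := homCategory
  whiskerLeft n _ _ τ := compMap (𝟙 n) τ
  whiskerRight σ m := compMap σ (𝟙 m)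
  associator p n m := assoc p n m
  leftUnitor m := leftUnit m
  rightUnitor m := rightUnit m
  whiskerLeft_id n m := comp_hom_ext fun c a b x y => rfl
  whiskerLeft_comp n _ _ _ σ τ := comp_hom_ext fun c a b x y => rfl
  id_whiskerLeft {B A m m'} τ := comp_hom_ext fun b a b' f y => by
    have h := app_map_app τ f y
    have h' := Comp.sound (n := Profunctor.id (C := B.cat)) (m := m') f (𝟙 b)
      ((τ.app b').app a y)
    refine Eq.trans ?_ (h'.trans (congrArg
      (fun t => (Comp.mk b (𝟙 b) t : Comp (Profunctor.id (C := B.cat)) m' b a)) h.symm))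
    exact congrArg (fun t => Comp.mk b' t _) (Category.comp_id (show b' ⟶ b from f)).symm
  comp_whiskerLeft p n _ _ τ := comp_hom_ext fun d a b w y => by
    induction w using Comp.ind with | _ c x z => _
    rfl
  id_whiskerRight n m := comp_hom_ext fun c a b x y => rfl
  comp_whiskerRight σ τ m := comp_hom_ext fun c a b x y => rfl
  whiskerRight_id {B A m m'} σ := comp_hom_ext fun b a a' x f => by
    have h := app_map σ (Quiver.Hom.op f) x
    have h' := Comp.sound (n := m') (m := Profunctor.id (C := A.cat)) (a := a) f
      ((σ.app b).app (op a') x) (𝟙 a.unop)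
    refine Eq.trans ?_ (h'.symm.trans (congrArg (fun t => Comp.mk _ t _) h.symm))
    exact congrArg (Comp.mk a' _) (Category.id_comp (show a.unop ⟶ a' from f)).symm
  whiskerRight_comp σ n m := comp_hom_ext fun d a c x w => by
    induction w using Comp.ind with | _ b z y => _
    rfl
  whisker_assoc p _ _ σ m := comp_hom_ext fun d a b w y => by
    induction w using Comp.ind with | _ c x z => _
    rfl
  whisker_exchange σ τ := comp_hom_ext fun c a b x y => rfl
  pentagon q p n m := comp_hom_ext fun e a b w y => by
    induction w using Comp.ind with | _ c w z => _
    induction w using Comp.ind with | _ d x t => _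
    rfl
  triangle n m := comp_hom_ext fun c a b w y => by
    induction w using Comp.ind with | _ b' x f => _
    exact (Comp.sound (n := n) (m := m) f x y).symm


/-- `f^*(b, a) = A(f b, a)` for a functor `f : B ⥤ A`. -/
abbrev upper {B A : SetMod.{u}} (f : B.cat ⥤ A.cat) : A ⟶ B :=
  f.toProfunctorRev

/-- `σ : f ⟶ g` induces `g^* ⟶ f^*`, precomposition with `σ_b`. -/
def upperMap {B A : SetMod.{u}} {f g : B.cat ⥤ A.cat} (σ : f ⟶ g) : upper g ⟶ upper f :=
  { app := fun a =>
      { app := fun b => ↾fun (x : g.obj b.unop ⟶ a) => σ.app b.unop ≫ x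
        naturality := fun b b' h => ConcreteCategory.hom_ext _ _ fun (x : g.obj b.unop ⟶ a) => by
          change σ.app b'.unop ≫ g.map h.unop ≫ x = f.map h.unop ≫ σ.app b.unop ≫ x
          simp }
    naturality := fun a a' h => NatTrans.ext (funext fun b =>
      ConcreteCategory.hom_ext _ _ fun (x : g.obj b.unop ⟶ a) =>
        (Category.assoc (σ.app b.unop) x h).symm) }

/-- `1^* = 1`. -/
def upperId (A : SetMod.{u}) : upper (𝟭 A.cat) ≅ 𝟙 A := Iso.refl _

/-- `(g ∘ f)^* ≅ f^* ∘ g^*`, given by `x ↦ [f c, x, 1]` with inverse `[b, x, y] ↦ x ∘ g y`. -/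
def upperComp {C B A : SetMod.{u}} (f : C.cat ⥤ B.cat) (g : B.cat ⥤ A.cat) :
    upper (B := C) (A := A) (f ⋙ g) ≅ upper g ≫ upper f :=
  isoMk
    { app := fun a =>
        { app := fun c => ↾fun (x : g.obj (f.obj c.unop) ⟶ a) =>
            Comp.mk (n := upper g) (m := upper f) (c := a) (a := c) (f.obj c.unop) x
              (𝟙 (f.obj c.unop))
          naturality := fun c c' h => ConcreteCategory.hom_ext _ _
            fun (x : g.obj (f.obj c.unop) ⟶ a) => by
              refine (Comp.sound (n := upper g) (m := upper f) (c := a) (a := c') (f.map h.unop) x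
                (𝟙 (f.obj c'.unop))).trans ?_
              refine congrArg (Comp.mk (n := upper g) (m := upper f) (c := a) (a := c')
                (f.obj c.unop) x) ?_
              exact (Category.id_comp (f.map h.unop)).trans (Category.comp_id _).symm }
      naturality := fun a a' h => rfl }
    { app := fun a =>
        { app := fun c => ↾Comp.lift
            (fun b (x : g.obj b ⟶ a) (y : f.obj c.unop ⟶ b) =>
              (g.map y ≫ x : g.obj (f.obj c.unop) ⟶ a))
            (fun {b b'} h (x : g.obj b' ⟶ a) (y : f.obj c.unop ⟶ b) => by
              change g.map y ≫ g.map h ≫ x = g.map (y ≫ h) ≫ x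
              simp)
          naturality := fun c c' h => comp_hom_ext₁
            fun b (x : g.obj b ⟶ a) (y : f.obj c.unop ⟶ b) => by
              change g.map (f.map h.unop ≫ y) ≫ x = g.map (f.map h.unop) ≫ g.map y ≫ x
              simp }
      naturality := fun a a' h => comp_hom_ext₂
        fun c b (x : g.obj b ⟶ a) (y : f.obj c.unop ⟶ b) =>
          (Category.assoc (g.map y) x h).symm }
    (fun a c (x : g.obj (f.obj c.unop) ⟶ a) => by
      change g.map (𝟙 (f.obj c.unop)) ≫ x = x
      simp)
    (fun a c z => by
      induction z using Comp.ind with | _ b x y => _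
      refine (Comp.sound (n := upper g) (m := upper f) (c := a) (a := c) y x
        (𝟙 (f.obj c.unop))).trans ?_
      exact congrArg (Comp.mk (n := upper g) (m := upper f) (c := a) (a := c) b x)
        (Category.id_comp (show f.obj c.unop ⟶ b from y)))

/-- The pseudofunctor `(-)^* : Cat^op ⥤ Mod^co`, the identity on objects, taking a functor `f` to
the module `f^*` and a natural transformation `σ : f ⟶ g` to `σ^* : g^* ⟶ f^*`. -/
def upperStar : Cat.{u, u}ᵒᵖ ⥤ᵖ Co SetMod.{u} where
  obj A := ⟨⟨A.unop⟩⟩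
  map f := Co.hom (upper (B := ⟨_⟩) (A := ⟨_⟩) f.unop.toFunctor)
  map₂ η := ⟨upperMap (B := ⟨_⟩) (A := ⟨_⟩) η.unop2.toNatTrans⟩
  map₂_id {A B} f := congrArg Co.Hom₂.mk (hom₂_ext fun a b
      (x : f.unop.toFunctor.obj b.unop ⟶ a) => Category.id_comp x)
  map₂_comp {A B f g h} η θ := congrArg Co.Hom₂.mk (hom₂_ext fun a b
      (x : h.unop.toFunctor.obj b.unop ⟶ a) =>
        Category.assoc (η.unop2.toNatTrans.app b.unop) (θ.unop2.toNatTrans.app b.unop) x)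
  mapId A := Co.iso (upperId ⟨A.unop⟩)
  mapComp f g := Co.iso
    (upperComp (C := ⟨_⟩) (B := ⟨_⟩) (A := ⟨_⟩) g.unop.toFunctor f.unop.toFunctor)
  map₂_whisker_left {A B C} f {g h} η := congrArg Co.Hom₂.mk (hom₂_ext fun a b
      (x : f.unop.toFunctor.obj (h.unop.toFunctor.obj b.unop) ⟶ a) => by
    change f.unop.toFunctor.map (η.unop2.toNatTrans.app b.unop) ≫ x =
      f.unop.toFunctor.map (η.unop2.toNatTrans.app b.unop ≫ 𝟙 _) ≫ x
    rw [Category.comp_id])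
  map₂_whisker_right {A B C f g} η h := congrArg Co.Hom₂.mk (hom₂_ext fun a b
      (x : g.unop.toFunctor.obj (h.unop.toFunctor.obj b.unop) ⟶ a) => by
    change η.unop2.toNatTrans.app (h.unop.toFunctor.obj b.unop) ≫ x =
      f.unop.toFunctor.map (𝟙 _) ≫ η.unop2.toNatTrans.app (h.unop.toFunctor.obj b.unop) ≫ x
    rw [CategoryTheory.Functor.map_id, Category.id_comp])
  map₂_associator f g h := congrArg Co.Hom₂.mk (hom₂_ext fun a b
      (x : f.unop.toFunctor.obj (g.unop.toFunctor.obj (h.unop.toFunctor.obj b.unop)) ⟶ a) => by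
    change 𝟙 _ ≫ x = f.unop.toFunctor.map (g.unop.toFunctor.map (𝟙 _)) ≫
      f.unop.toFunctor.map (𝟙 _) ≫ x
    simp)
  map₂_left_unitor f := congrArg Co.Hom₂.mk (hom₂_ext fun a b
      (x : f.unop.toFunctor.obj b.unop ⟶ a) => by
    change 𝟙 _ ≫ x = x ≫ 𝟙 _
    rw [Category.id_comp, Category.comp_id])
  map₂_right_unitor f := congrArg Co.Hom₂.mk (hom₂_ext fun a b
      (x : f.unop.toFunctor.obj b.unop ⟶ a) => by
    change 𝟙 _ ≫ x = f.unop.toFunctor.map (𝟙 _) ≫ x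
    rw [CategoryTheory.Functor.map_id])

end SetMod

/-! In modules every functor `f` gives an adjunction `f_* ⊣ f^*`; reversing 2-cells makes `f^*` a
left adjoint in `Mod^co`, which settles (H1) and the adjoint required in (H2). For (H2), read in
`Cat`: a cofibration of `Cat^op` is a fibration `p : X ⥤ A`, and a bipushout is a pseudopullback `Q`
of `p` and `q : Y ⥤ A`, with projections `h`, `k` and an isomorphism `θ : q k ≅ p h`. The mate is a
map of coends `∫^w X(h w, x) × Y(y, k w) → ∫^a A(a, p x) × A(q y, a)`. By co-Yoneda the target is
`A(q y, p x)`, and the map sends `[w, s, t]` to `p(s) ∘ θ_w ∘ q(t)` (`squareMate_app_mk`). It is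
surjective because a lift of `q y ⟶ p x` along `p` determines an object of `Q`; it is injective
because any two triples with the same composite are joined by spans in `Q` (`exists_factorization`).
Equality in a coend needs only the existence of such spans, so weak universal properties suffice.
They are read off the bicategorical definitions by mapping out of the terminal category; cartesian
lifts come from the right adjoint of `E ↓ E ⟶ A ↓ p` (`hasWeakCartesianLifts_of_adjunction`). -/

namespace CategoryTheory.Bicategory.Adjunction

/-! ### Invertibility of a mate is independent of the chosen right adjoints. -/

variable {B : Type u} [Bicategory.{w, v} B]

section
variable {a b : B} {l : a ⟶ b} {r r' : b ⟶ a} (adj : l ⊣ r) (adj' : l ⊣ r')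

/-- The conjugate of `𝟙 l` is the canonical comparison `r ⟶ r'`. Sliding the two units past each
other leaves a zigzag of `adj`, which collapses. -/
theorem unit_conjugateEquiv_id :
    adj.unit ≫ l ◁ conjugateEquiv adj adj' (𝟙 l) = adj'.unit := by
  rw [conjugateEquiv_apply']
  calc
    _ = 𝟙 _ ⊗≫ (adj.unit ▷ 𝟙 a ≫ (l ≫ r) ◁ adj'.unit) ⊗≫ l ◁ adj.counit ▷ r' ⊗≫ 𝟙 _ := by
      bicategory
    _ = adj'.unit ⊗≫ leftZigzag adj.unit adj.counit ▷ r' ⊗≫ 𝟙 _ := by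
      rw [← whisker_exchange]; bicategory
    _ = _ := by rw [adj.left_triangle]; bicategory

theorem conjugateEquiv_id_counit :
    conjugateEquiv adj adj' (𝟙 l) ▷ l ≫ adj'.counit = adj.counit := by
  rw [conjugateEquiv_apply']
  calc
    _ = 𝟙 _ ⊗≫ r ◁ adj'.unit ▷ l ⊗≫ (adj.counit ▷ (r' ≫ l) ≫ 𝟙 b ◁ adj'.counit) ⊗≫ 𝟙 _ := by
      bicategory
    _ = 𝟙 _ ⊗≫ r ◁ leftZigzag adj'.unit adj'.counit ⊗≫ adj.counit := by
      rw [← whisker_exchange]; bicategory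
    _ = _ := by rw [adj'.left_triangle]; bicategory

end

/-- An adjunction from triangle identities stated with the associators. -/
def mkOfTriangles {a b : B} {l : a ⟶ b} {r : b ⟶ a} (η : 𝟙 a ⟶ l ≫ r) (e : r ≫ l ⟶ 𝟙 b)
    (h₁ : η ▷ l ≫ (α_ l r l).hom ≫ l ◁ e = (λ_ l).hom ≫ (ρ_ l).inv)
    (h₂ : r ◁ η ≫ (α_ r l r).inv ≫ e ▷ r = (ρ_ r).hom ≫ (λ_ r).inv) : l ⊣ r where
  unit := η
  counit := e
  left_triangle := by rw [← h₁]; bicategory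
  right_triangle := by rw [← h₂]; bicategory

theorem mateEquiv_change {a b c d : B} {l : a ⟶ b} {r r' : b ⟶ a} (adj : l ⊣ r) (adj' : l ⊣ r')
    {m : c ⟶ d} {s s' : d ⟶ c} (adm : m ⊣ s) (adm' : m ⊣ s') {g : a ⟶ c} {h : b ⟶ d}
    (α : g ≫ m ⟶ l ≫ h) :
    mateEquiv adj' adm' α = conjugateEquiv adj' adj (𝟙 l) ▷ g ≫ mateEquiv adj adm α ≫
      h ◁ conjugateEquiv adm adm' (𝟙 m) := by
  -- Once the new unit and counit are written through the old ones and the comparisons `k` and `e`,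
  -- only interchange is needed to move `k` and `e` to the outside.
  rw [mateEquiv_apply', mateEquiv_apply', ← unit_conjugateEquiv_id adm adm',
    ← conjugateEquiv_id_counit adj' adj]
  set e := conjugateEquiv adj' adj (𝟙 l)
  set k := conjugateEquiv adm adm' (𝟙 m)
  calc
    _ = 𝟙 _ ⊗≫ r' ◁ g ◁ adm.unit ⊗≫ r' ◁ ((g ≫ m) ◁ k ≫ α ▷ s') ⊗≫
          (e ▷ l ≫ adj.counit) ▷ h ▷ s' ⊗≫ 𝟙 _ := by bicategory
    _ = 𝟙 _ ⊗≫ r' ◁ g ◁ adm.unit ⊗≫ r' ◁ α ▷ s ⊗≫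
          (((r' ≫ l) ≫ h) ◁ k ≫ ((e ▷ l ≫ adj.counit) ▷ h) ▷ s') ⊗≫ 𝟙 _ := by
      rw [whisker_exchange]; bicategory
    _ = 𝟙 _ ⊗≫ r' ◁ (g ◁ adm.unit ⊗≫ α ▷ s) ⊗≫
          (e ▷ (l ≫ h ≫ s)) ⊗≫ adj.counit ▷ h ▷ s ⊗≫ h ◁ k ⊗≫ 𝟙 _ := by
      rw [whisker_exchange]; bicategory
    _ = 𝟙 _ ⊗≫ (r' ◁ (g ◁ adm.unit ⊗≫ α ▷ s ≫ (α_ _ _ _).hom) ≫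
          (e ▷ (l ≫ h ≫ s))) ⊗≫ adj.counit ▷ h ▷ s ⊗≫ h ◁ k ⊗≫ 𝟙 _ := by
      bicategory
    _ = _ := by
      rw [whisker_exchange]; bicategory

instance isIso_conjugateEquiv_id {a b : B} {l : a ⟶ b} {r r' : b ⟶ a} (adj : l ⊣ r) (adj' : l ⊣ r') :
    IsIso (conjugateEquiv adj adj' (𝟙 l)) :=
  ⟨conjugateEquiv adj' adj (𝟙 l), by simp [conjugateEquiv_comp], by simp [conjugateEquiv_comp]⟩

theorem isIso_mateEquiv_of_isIso {a b c d : B} {l : a ⟶ b} {r r' : b ⟶ a} (adj : l ⊣ r)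
    (adj' : l ⊣ r') {m : c ⟶ d} {s s' : d ⟶ c} (adm : m ⊣ s) (adm' : m ⊣ s') {g : a ⟶ c}
    {h : b ⟶ d} (α : g ≫ m ⟶ l ≫ h) [IsIso (mateEquiv adj adm α)] :
    IsIso (mateEquiv adj' adm' α) := by
  rw [mateEquiv_change adj adj' adm adm']
  infer_instance

end CategoryTheory.Bicategory.Adjunction

/-! ### The adjunction between `f_*` and `f^*`. -/

namespace SetMod

/-- `f_*(a, b) = A(a, f b)` for a functor `f : B ⥤ A`. -/
abbrev lower {B A : SetMod.{u}} (f : B.cat ⥤ A.cat) : B ⟶ A :=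
  f.toProfunctor

variable {B A : SetMod.{u}} (f : B.cat ⥤ A.cat)

/-- The composition `[b, x, y] ↦ y ≫ x`, a `2`-cell `f_* ∘ f^* ⟶ 1`. -/
def upperLowerCounit : upper f ≫ lower f ⟶ 𝟙 A where
  app c :=
    { app := fun a => ↾Comp.lift (n := upper f) (m := lower f)
        (fun b (x : f.obj b ⟶ c) (y : a.unop ⟶ f.obj b) => (y ≫ x : a.unop ⟶ c))
        (fun {b b'} g (x : f.obj b' ⟶ c) (y : a.unop ⟶ f.obj b) =>
          (Category.assoc y (f.map g) x).symm)
      naturality := fun a _ g => comp_hom_ext₁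
        fun b (x : f.obj b ⟶ c) (y : a.unop ⟶ f.obj b) => Category.assoc g.unop y x }
  naturality c _ h := comp_hom_ext₂
    fun a b (x : f.obj b ⟶ c) (y : a.unop ⟶ f.obj b) => (Category.assoc y x h).symm

/-- The action on morphisms `g ↦ [f b', f g, 1]`, a `2`-cell `1 ⟶ f^* ∘ f_*`. -/
def lowerUpperUnit : 𝟙 B ⟶ lower f ≫ upper f where
  app b :=
    { app := fun b' => ↾fun (g : b'.unop ⟶ b) =>
        (Comp.mk (n := lower f) (m := upper f) (c := b) (a := b') (f.obj b'.unop) (f.map g)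
          (𝟙 (f.obj b'.unop)))
      naturality := fun b' b'' h => ConcreteCategory.hom_ext _ _ fun (g : b'.unop ⟶ b) => by
        change Comp.mk (n := lower f) (m := upper f) (c := b) (a := b'') (f.obj b''.unop)
          (f.map (h.unop ≫ g)) (𝟙 (f.obj b''.unop)) =
          Comp.mk (n := lower f) (m := upper f) (c := b) (a := b'') (f.obj b'.unop)
          (f.map g) (f.map h.unop ≫ 𝟙 _)
        rw [f.map_comp, Category.comp_id]
        refine (Comp.sound (n := lower f) (m := upper f) (c := b) (a := b'') (f.map h.unop)
          (f.map g) (𝟙 _)).trans ?_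
        refine congrArg (Comp.mk (n := lower f) (m := upper f) (c := b) (a := b'') _ _) ?_
        exact Category.id_comp (f.map h.unop) }
  naturality b b₁ h := NatTrans.ext (funext fun b' => ConcreteCategory.hom_ext _ _
    fun (g : b'.unop ⟶ b) => congrArg
      (fun t => Comp.mk (n := lower f) (m := upper f) (c := b₁) (a := b') _ t _) (f.map_comp g h))

/-- In `Mod^co` the module `f^*` is left adjoint to `f_*`. -/
def upperAdjLower : Co.hom (upper f) ⊣ Co.hom (lower f) :=
  Adjunction.mkOfTriangles ⟨upperLowerCounit f⟩ ⟨lowerUpperUnit f⟩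
  (congrArg Co.Hom₂.mk (comp_hom_ext fun a b b'
      (x : f.obj b' ⟶ a) (y : b.unop ⟶ b') => by
    change Comp.mk (n := 𝟙 A) (m := upper f) (c := a) (a := b) (f.obj b.unop)
        (f.map y ≫ x) (𝟙 (f.obj b.unop)) =
      Comp.mk (n := 𝟙 A) (m := upper f) (c := a) (a := b) a (𝟙 a) (f.map y ≫ x)
    -- The two representatives differ by sliding `f.map y ≫ x` across the coend; the other triangle
    -- slides `y` in the same way.
    have := Comp.sound (n := 𝟙 A) (m := upper f) (c := a) (a := b) (f.map y ≫ x) (𝟙 a)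
      (𝟙 (f.obj b.unop))
    refine Eq.trans ?_ (this.trans ?_)
    · exact congrArg (fun t => Comp.mk (n := 𝟙 A) (m := upper f) (c := a) (a := b) _ t _)
        (Category.comp_id (f.map y ≫ x)).symm
    · exact congrArg (Comp.mk (n := 𝟙 A) (m := upper f) (c := a) (a := b) _ _)
        (Category.id_comp (f.map y ≫ x))))
  (congrArg Co.Hom₂.mk (comp_hom_ext fun b a b'
      (h : b' ⟶ b) (y : a.unop ⟶ f.obj b') => by
    change Comp.mk (n := lower f) (m := 𝟙 A) (c := b) (a := a) (f.obj b')
        (f.map h) (y ≫ 𝟙 (f.obj b')) =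
      Comp.mk (n := lower f) (m := 𝟙 A) (c := b) (a := a) a.unop (y ≫ f.map h) (𝟙 a.unop)
    rw [Category.comp_id]
    refine Eq.trans ?_ (Comp.sound (n := lower f) (m := 𝟙 A) (c := b) (a := a) y (f.map h)
      (𝟙 a.unop)).symm
    exact congrArg (Comp.mk (n := lower f) (m := 𝟙 A) (c := b) (a := a) _ _)
      (Category.id_comp y).symm))

end SetMod

/-! ### Factorizations through a pseudopullback of a fibration. -/

namespace CategoryTheory.Functor

variable {A X Y Q : Type u} [Category.{u} A] [Category.{u} X] [Category.{u} Y] [Category.{u} Q]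

/-- Every morphism into the image of an object lifts, up to isomorphism, to a morphism through
which the other lifts factor. Factorizations are not required to be unique. -/
def HasWeakCartesianLifts (p : X ⥤ A) : Prop :=
  ∀ (x : X) (a : A) (f : a ⟶ p.obj x), ∃ (x' : X) (g : x' ⟶ x) (e : p.obj x' ≅ a),
    p.map g = e.hom ≫ f ∧ ∀ (x'' : X) (g' : x'' ⟶ x) (v : p.obj x'' ⟶ a), p.map g' = v ≫ f →
      ∃ u : x'' ⟶ x', u ≫ g = g' ∧ p.map u ≫ e.hom = v

variable {p : X ⥤ A} {q : Y ⥤ A} {h : Q ⥤ X} {k : Q ⥤ Y}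

/-- Weak form of the universal property of a pseudopullback, without uniqueness of the lifts of
morphisms. -/
structure IsWeakPseudopullback (θ : k ⋙ q ≅ h ⋙ p) : Prop where
  exists_obj (x : X) (y : Y) (e : p.obj x ≅ q.obj y) :
    ∃ (w : Q) (a : h.obj w ≅ x) (b : k.obj w ≅ y),
      q.map b.hom = θ.hom.app w ≫ p.map a.hom ≫ e.hom
  exists_hom (w w' : Q) (f : h.obj w ⟶ h.obj w') (g : k.obj w ⟶ k.obj w')
    (hfg : q.map g ≫ θ.hom.app w' = θ.hom.app w ≫ p.map f) :
    ∃ m : w ⟶ w', h.map m = f ∧ k.map m = g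

/-- This is the bijectivity of the mate in elementary terms: existence gives surjectivity, and
uniqueness of the coend class gives injectivity. -/
theorem IsWeakPseudopullback.exists_factorization {θ : k ⋙ q ≅ h ⋙ p}
    (hθ : IsWeakPseudopullback θ) (hp : p.HasWeakCartesianLifts) {x : X} {y : Y} (f : q.obj y ⟶ p.obj x) :
    ∃ (w : Q) (s : h.obj w ⟶ x) (t : y ⟶ k.obj w),
      q.map t ≫ θ.hom.app w ≫ p.map s = f ∧
      ∀ (w' : Q) (s' : h.obj w' ⟶ x) (t' : y ⟶ k.obj w'),
        q.map t' ≫ θ.hom.app w' ≫ p.map s' = f →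
        SetMod.Comp.mk (n := h.toProfunctorRev) (m := k.toProfunctor) (c := x) (a := op y)
          w' s' t' =
        SetMod.Comp.mk (n := h.toProfunctorRev) (m := k.toProfunctor) (c := x) (a := op y)
          w s t := by
  obtain ⟨x₀, g, e, hg, hu⟩ := hp x _ f
  obtain ⟨w₀, a₀, b₀, h₀⟩ := hθ.exists_obj x₀ y e
  have h₀' : θ.hom.app w₀ = q.map b₀.hom ≫ e.inv ≫ p.map a₀.inv := by
    rw [h₀]; simp [← Functor.map_comp]
  -- The chosen triple has the lift `g` of `f` as its first leg and an isomorphism as its second.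
  refine ⟨w₀, a₀.hom ≫ g, b₀.inv, ?_, fun w s t hf => ?_⟩
  · rw [h₀', p.map_comp, hg]; simp [← Functor.map_comp_assoc]
  -- Lifting this composite gives an object `w₁` lying over `y` up to isomorphism, with `m : w₁ ⟶ w`
  -- over `t`. Factoring `g₁ ≫ s` through `g` gives `m' : w₁ ⟶ w₀`. The coend relations along `m`
  -- and `m'` then have a common left side.
  obtain ⟨x₁, g₁, e₁, hg₁, -⟩ := hp (h.obj w) _ (q.map t ≫ θ.hom.app w)
  obtain ⟨w₁, a₁, b₁, h₁⟩ := hθ.exists_obj x₁ y e₁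
  obtain ⟨m, hm, hm'⟩ := hθ.exists_hom w₁ w (a₁.hom ≫ g₁) (b₁.hom ≫ t) (by
    rw [q.map_comp, h₁, p.map_comp, hg₁]; simp)
  obtain ⟨v, hv, hv'⟩ := hu x₁ (g₁ ≫ s) e₁.hom (by
    rw [p.map_comp, hg₁, ← hf]; simp)
  obtain ⟨m', hl, hl'⟩ := hθ.exists_hom w₁ w₀ (a₁.hom ≫ v ≫ a₀.inv) (b₁.hom ≫ b₀.inv) (by
    rw [h₀', q.map_comp, h₁, ← hv']
    simp [← Functor.map_comp, ← Functor.map_comp_assoc])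
  have hs := SetMod.Comp.sound (n := h.toProfunctorRev) (m := k.toProfunctor) (c := x)
    (a := op y) m s b₁.inv
  have hs' := SetMod.Comp.sound (n := h.toProfunctorRev) (m := k.toProfunctor) (c := x)
    (a := op y) m' (a₀.hom ≫ g) b₁.inv
  have e1 : h.map m ≫ s = h.map m' ≫ a₀.hom ≫ g := by rw [hm, hl]; simp [hv]
  have e2 : b₁.inv ≫ k.map m = t := by rw [hm']; simp
  have e3 : b₁.inv ≫ k.map m' = b₀.inv := by rw [hl']; simp
  change SetMod.Comp.mk (n := h.toProfunctorRev) (m := k.toProfunctor) (c := x) (a := op y)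
    w₁ (h.map m ≫ s) b₁.inv = SetMod.Comp.mk (n := h.toProfunctorRev) (m := k.toProfunctor)
      (c := x) (a := op y) w s (b₁.inv ≫ k.map m) at hs
  change SetMod.Comp.mk (n := h.toProfunctorRev) (m := k.toProfunctor) (c := x) (a := op y)
    w₁ (h.map m' ≫ a₀.hom ≫ g) b₁.inv = SetMod.Comp.mk (n := h.toProfunctorRev)
      (m := k.toProfunctor) (c := x) (a := op y) w₀ (a₀.hom ≫ g) (b₁.inv ≫ k.map m') at hs'
  rw [e1, e2] at hs
  rw [e3] at hs'
  exact hs.symm.trans hs'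

end CategoryTheory.Functor

/-! ### The mate computed on coend representatives, and its bijectivity. -/

namespace SetMod

variable {A B C D : Cat.{u, u}ᵒᵖ} {i : A ⟶ B} {j : A ⟶ C} {h : B ⟶ D} {k : C ⟶ D}

/-- The mate of the image of a square, with respect to the adjunctions `f^* ⊣ f_*`. -/
abbrev squareMate (θ : j ≫ k ≅ i ≫ h) :=
  mateEquiv (upperAdjLower (B := ⟨B.unop⟩) (A := ⟨A.unop⟩) i.unop.toFunctor)
    (upperAdjLower (B := ⟨D.unop⟩) (A := ⟨C.unop⟩) k.unop.toFunctor)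
    (mapSquare upperStar θ.hom)

theorem squareMate_app_mk (θ : j ≫ k ≅ i ≫ h) (x : B.unop) (y : C.unop) (w : D.unop)
    (s : h.unop.toFunctor.obj w ⟶ x) (t : y ⟶ k.unop.toFunctor.obj w) :
    ((squareMate θ).unco₂.app x).app (op y)
      (Comp.mk (n := h.unop.toFunctor.toProfunctorRev) (m := k.unop.toFunctor.toProfunctor)
        (c := x) (a := op y) w s t) =
    Comp.mk (n := i.unop.toFunctor.toProfunctor) (m := j.unop.toFunctor.toProfunctorRev)
        (c := x) (a := op y) (i.unop.toFunctor.obj x) (𝟙 _)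
        (j.unop.toFunctor.map t ≫ θ.hom.unop2.toNatTrans.app w ≫ i.unop.toFunctor.map s) := by
  -- The middle term is what the unit, the square and the counit produce by unfolding on a
  -- representative; only identities remain to be removed.
  refine Eq.trans (b := Comp.mk (n := i.unop.toFunctor.toProfunctor)
    (m := j.unop.toFunctor.toProfunctorRev)
        (c := x) (a := op y) (i.unop.toFunctor.obj x) (i.unop.toFunctor.map (𝟙 x))
        (j.unop.toFunctor.map (t ≫ 𝟙 _) ≫ θ.hom.unop2.toNatTrans.app w ≫
          i.unop.toFunctor.map s ≫ 𝟙 _)) rfl ?_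
  simp

end SetMod

namespace Co

theorem isIso_of_isIso_unco₂ {K : Type u} [Bicategory.{w, v} K] {a b : Co K} {f g : a ⟶ b}
    (η : f ⟶ g) [IsIso η.unco₂] : IsIso η :=
  ⟨⟨inv η.unco₂⟩, congrArg Hom₂.mk (IsIso.inv_hom_id η.unco₂),
    congrArg Hom₂.mk (IsIso.hom_inv_id η.unco₂)⟩

end Co

namespace SetMod

theorem isIso_of_bijective {B A : SetMod.{u}} {m m' : B ⟶ A} (σ : m ⟶ m')
    (hσ : ∀ b a, Function.Bijective (NatTrans.app (NatTrans.app σ b) a)) : IsIso σ := by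
  have (b : B.cat) : IsIso (NatTrans.app σ b) := by
    have (a : (A.cat)ᵒᵖ) : IsIso (NatTrans.app (NatTrans.app σ b) a) :=
      (isIso_iff_bijective _).2 (hσ b a)
    exact NatIso.isIso_of_isIso_app _
  exact NatIso.isIso_of_isIso_app (C := B.cat) (D := (A.cat)ᵒᵖ ⥤ Type u) σ

section

variable {A X Y : Type u} [Category.{u} A] [Category.{u} X] [Category.{u} Y] (p : X ⥤ A)
  (q : Y ⥤ A) {x : X} {y : Y}

/-- Normal form for co-Yoneda: slide `u` across, so that the class is recorded by the composite `v ≫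
u`. -/
theorem mk_lower_upper_eq (a : A) (u : a ⟶ p.obj x) (v : q.obj y ⟶ a) :
    Comp.mk (n := p.toProfunctor) (m := q.toProfunctorRev) (c := x) (a := op y) a u v =
      Comp.mk (n := p.toProfunctor) (m := q.toProfunctorRev) (c := x) (a := op y) (p.obj x)
        (𝟙 _) (v ≫ u) :=
  (congrArg (fun t => Comp.mk (n := p.toProfunctor) (m := q.toProfunctorRev) (c := x)
    (a := op y) a t v) (Category.comp_id u).symm).trans
    (Comp.sound (n := p.toProfunctor) (m := q.toProfunctorRev) (c := x) (a := op y) u (𝟙 _) v)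

/-- Composition respects the coend relation, so it recovers the composite from the class. -/
theorem mk_lower_upper_injective {f g : q.obj y ⟶ p.obj x}
    (hfg : Comp.mk (n := p.toProfunctor) (m := q.toProfunctorRev) (c := x) (a := op y) (p.obj x)
        (𝟙 _) f = Comp.mk (n := p.toProfunctor) (m := q.toProfunctorRev) (c := x) (a := op y)
        (p.obj x) (𝟙 _) g) : f = g := by
  have := congrArg (Comp.lift (n := p.toProfunctor) (m := q.toProfunctorRev) (c := x)
    (a := op y) (T := q.obj y ⟶ p.obj x)
    (fun a (u : a ⟶ p.obj x) (v : q.obj y ⟶ a) => v ≫ u)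
    (fun {a a'} k (u : a' ⟶ p.obj x) (v : q.obj y ⟶ a) => (Category.assoc v k u).symm)) hfg
  exact (Category.comp_id f).symm.trans (this.trans (Category.comp_id g))

end

variable {A B C D : Cat.{u, u}ᵒᵖ} {i : A ⟶ B} {j : A ⟶ C} {h : B ⟶ D} {k : C ⟶ D}

theorem isIso_squareMate (θ : j ≫ k ≅ i ≫ h)
    (hp : i.unop.toFunctor.HasWeakCartesianLifts)
    (hθ : Functor.IsWeakPseudopullback (p := i.unop.toFunctor) (q := j.unop.toFunctor)
      (h := h.unop.toFunctor) (k := k.unop.toFunctor) (Cat.Hom.toNatIso θ.unop2)) :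
    IsIso (squareMate θ) := by
  have : IsIso (squareMate θ).unco₂ := isIso_of_bijective _ fun x y => by
    constructor
    · intro z z' hz
      induction z using Comp.ind with | _ w s t => _
      induction z' using Comp.ind with | _ w' s' t' => _
      have := mk_lower_upper_injective _ _
        ((squareMate_app_mk θ x y.unop w s t).symm.trans
        (hz.trans (squareMate_app_mk θ x y.unop w' s' t')))
      obtain ⟨_, _, _, _, hu⟩ := hθ.exists_factorization hp
        (j.unop.toFunctor.map t' ≫ θ.hom.unop2.toNatTrans.app w' ≫ i.unop.toFunctor.map s')
      exact (hu w s t this).trans (hu w' s' t' rfl).symm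
    · intro z
      induction z using Comp.ind with | _ a u v => _
      obtain ⟨w, s, t, hf, _⟩ := hθ.exists_factorization hp (x := x) (y := y.unop) (v ≫ u)
      refine ⟨Comp.mk (n := h.unop.toFunctor.toProfunctorRev) (m := k.unop.toFunctor.toProfunctor)
        (c := x) (a := y) w s t, ?_⟩
      refine (squareMate_app_mk θ x y.unop w s t).trans ?_
      refine Eq.trans ?_ (mk_lower_upper_eq i.unop.toFunctor j.unop.toFunctor a u v).symm
      exact congrArg (Comp.mk (n := i.unop.toFunctor.toProfunctor)
        (m := j.unop.toFunctor.toProfunctorRev) (c := x) (a := y) _ _) hf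
  exact Co.isIso_of_isIso_unco₂ _

theorem isLeftAdjoint_upperStar_map (i : A ⟶ B) : IsLeftAdjoint (upperStar.map i) :=
  .mk (upperAdjLower (B := ⟨B.unop⟩) (A := ⟨A.unop⟩) i.unop.toFunctor)

end SetMod

/-! ### Cartesian lifts from the slice criterion for fibrations. -/

namespace CategoryTheory.Functor

/-- Weak form of the universal property of a comma category, without uniqueness of the lifts of
morphisms. -/
structure IsWeakComma {A B C S : Type u} [Category.{u} A] [Category.{u} B] [Category.{u} C]
    [Category.{u} S] {F : A ⥤ C} {G : B ⥤ C} {s : S ⥤ A} {t : S ⥤ B} (lam : s ⋙ F ⟶ t ⋙ G) :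
    Prop where
  exists_obj (a : A) (b : B) (f : F.obj a ⟶ G.obj b) :
    ∃ (z : S) (α : s.obj z ≅ a) (β : t.obj z ≅ b), F.map α.hom ≫ f = lam.app z ≫ G.map β.hom
  exists_hom (z z' : S) (f : s.obj z ⟶ s.obj z') (g : t.obj z ⟶ t.obj z')
    (hfg : F.map f ≫ lam.app z' = lam.app z ≫ G.map g) :
    ∃ m : z ⟶ z', s.map m = f ∧ t.map m = g

/-- A morphism `f : a ⟶ p e` is an object of `A ↓ p`; its image under `r` is an arrow of `E` lying
over it because the counit is invertible, and transposition across the adjunction yields the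
factorizations. Only the existence of transposes matters, so one triangle identity suffices and the
unit may be any family of morphisms. -/
theorem hasWeakCartesianLifts_of_adjunction {A E S₀ S₁ : Type u} [Category.{u} A] [Category.{u} E]
    [Category.{u} S₀] [Category.{u} S₁] {p : E ⥤ A} {s₀ t₀ : S₀ ⥤ E} {s₁ : S₁ ⥤ A} {t₁ : S₁ ⥤ E}
    {lam₀ : s₀ ⋙ 𝟭 E ⟶ t₀ ⋙ 𝟭 E} {lam₁ : s₁ ⋙ 𝟭 A ⟶ t₁ ⋙ p} (h₀ : IsWeakComma lam₀)
    (h₁ : IsWeakComma lam₁) {P : S₀ ⥤ S₁} {r : S₁ ⥤ S₀} (σ : s₀ ⋙ p ≅ P ⋙ s₁)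
    (τ : P ⋙ t₁ ≅ t₀)
    (hστ : ∀ z, σ.hom.app z ≫ lam₁.app (P.obj z) ≫ p.map (τ.hom.app z) = p.map (lam₀.app z))
    (unit : ∀ z, z ⟶ r.obj (P.obj z)) (counit : r ⋙ P ≅ 𝟭 S₁)
    (htri : ∀ z, P.map (unit z) ≫ counit.hom.app (P.obj z) = 𝟙 _) :
    p.HasWeakCartesianLifts := by
  have lam₀_nat {z z' : S₀} (n : z ⟶ z') : s₀.map n ≫ lam₀.app z' = lam₀.app z ≫ t₀.map n :=
    lam₀.naturality n
  have lam₁_nat {z z' : S₁} (n : z ⟶ z') :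
      s₁.map n ≫ lam₁.app z' = lam₁.app z ≫ p.map (t₁.map n) :=
    lam₁.naturality n
  have σ_nat {z z' : S₀} (n : z ⟶ z') :
      p.map (s₀.map n) ≫ σ.hom.app z' = σ.hom.app z ≫ s₁.map (P.map n) :=
    σ.hom.naturality n
  have τ_nat {z z' : S₀} (n : z ⟶ z') :
      t₀.map n ≫ τ.inv.app z' = τ.inv.app z ≫ t₁.map (P.map n) :=
    τ.inv.naturality n
  have hστ' (z : S₀) : p.map (lam₀.app z) ≫ p.map (τ.inv.app z) =
      σ.hom.app z ≫ lam₁.app (P.obj z) := by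
    rw [← hστ]; simp [← Functor.map_comp]
  have hστ'' (z : S₀) : σ.inv.app z ≫ p.map (lam₀.app z) =
      lam₁.app (P.obj z) ≫ p.map (τ.hom.app z) := by
    rw [← hστ]; simp
  intro e a f
  obtain ⟨z₁, α, β, hαβ⟩ := h₁.exists_obj a e f
  change α.hom ≫ f = lam₁.app z₁ ≫ p.map β.hom at hαβ
  let δ : P.obj (r.obj z₁) ≅ z₁ := counit.app z₁
  -- The lift is the arrow classified by `r.obj z₁`, with its codomain identified with `e` through
  -- `τ`, the counit and `β`.
  refine ⟨s₀.obj (r.obj z₁), lam₀.app (r.obj z₁) ≫ τ.inv.app (r.obj z₁) ≫ t₁.map δ.hom ≫ β.hom,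
    σ.app (r.obj z₁) ≪≫ s₁.mapIso δ ≪≫ α, ?_, fun e'' g' v hv => ?_⟩
  · calc
      _ = (p.map (lam₀.app (r.obj z₁)) ≫ p.map (τ.inv.app (r.obj z₁))) ≫ p.map (t₁.map δ.hom) ≫
          p.map β.hom := by simp
      _ = σ.hom.app (r.obj z₁) ≫ (lam₁.app _ ≫ p.map (t₁.map δ.hom)) ≫ p.map β.hom := by
        rw [hστ', Category.assoc, Category.assoc]
      _ = _ := by
        rw [← lam₁_nat, Category.assoc, ← hαβ]; simp
  · obtain ⟨w, α', β', hαβ'⟩ := h₀.exists_obj e'' e g'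
    change α'.hom ≫ g' = lam₀.app w ≫ β'.hom at hαβ'
    have hα : α.inv ≫ lam₁.app z₁ = f ≫ p.map β.inv := by
      rw [Iso.inv_comp_eq, ← Category.assoc, hαβ, Category.assoc, ← p.map_comp]; simp
    -- With `g'` viewed as the object `w` of `E ↓ E`, the equation `p.map g' = v ≫ f` is a morphism
    -- from its image to `z₁`. Its transpose `n` has the required factorization as source component.
    obtain ⟨m, hm, hm'⟩ := h₁.exists_hom (P.obj w) z₁
      (σ.inv.app w ≫ p.map α'.hom ≫ v ≫ α.inv) (τ.hom.app w ≫ β'.hom ≫ β.inv) (by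
        change (σ.inv.app w ≫ p.map α'.hom ≫ v ≫ α.inv) ≫ lam₁.app z₁ =
          lam₁.app (P.obj w) ≫ p.map (τ.hom.app w ≫ β'.hom ≫ β.inv)
        calc
          _ = σ.inv.app w ≫ p.map α'.hom ≫ (v ≫ f) ≫ p.map β.inv := by
            simp only [Category.assoc, hα]
          _ = σ.inv.app w ≫ p.map (α'.hom ≫ g') ≫ p.map β.inv := by
            rw [← hv, p.map_comp, Category.assoc]
          _ = (σ.inv.app w ≫ p.map (lam₀.app w)) ≫ p.map β'.hom ≫ p.map β.inv := by
            rw [hαβ', p.map_comp]; simp only [Category.assoc]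
          _ = _ := by
            rw [hστ'', p.map_comp, p.map_comp, Category.assoc])
    have hn : P.map (unit w ≫ r.map m) ≫ δ.hom = m := by
      have := counit.hom.naturality m
      change P.map (r.map m) ≫ δ.hom = counit.hom.app (P.obj w) ≫ m at this
      rw [P.map_comp, Category.assoc, this, ← Category.assoc, htri, Category.id_comp]
    generalize unit w ≫ r.map m = n at hn
    refine ⟨α'.inv ≫ s₀.map n, ?_, ?_⟩
    · calc
        _ = α'.inv ≫ (s₀.map n ≫ lam₀.app _) ≫ τ.inv.app _ ≫ t₁.map δ.hom ≫ β.hom := by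
          simp only [Category.assoc]
        _ = α'.inv ≫ lam₀.app w ≫ (t₀.map n ≫ τ.inv.app _) ≫ t₁.map δ.hom ≫ β.hom := by
          rw [lam₀_nat]; simp only [Category.assoc]
        _ = α'.inv ≫ lam₀.app w ≫ τ.inv.app w ≫ t₁.map (P.map n ≫ δ.hom) ≫ β.hom := by
          rw [τ_nat, t₁.map_comp]; simp only [Category.assoc]
        _ = α'.inv ≫ (lam₀.app w ≫ β'.hom) := by
          rw [hn, hm']; simp
        _ = g' := by rw [← hαβ']; simp
    · calc
        _ = p.map α'.inv ≫ (p.map (s₀.map n) ≫ σ.hom.app _) ≫ s₁.map δ.hom ≫ α.hom := by simp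
        _ = p.map α'.inv ≫ σ.hom.app w ≫ s₁.map (P.map n ≫ δ.hom) ≫ α.hom := by
          rw [σ_nat, s₁.map_comp]; simp only [Category.assoc]
        _ = v := by rw [hn, hm]; simp [← Functor.map_comp_assoc]

end CategoryTheory.Functor

/-! ### Universal properties tested on the terminal category. -/

namespace CategoryTheory.Cat

/-- The terminal category, as an object of `Catᵒᵖᵒᵖ`. -/
abbrev opOpPoint : Cat.{u, u}ᵒᵖᵒᵖ := op (op (Cat.of (Discrete PUnit.{u + 1})))

variable {C : Cat.{u, u}ᵒᵖᵒᵖ}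

/-- The object of a category picked by a functor from the terminal category. -/
abbrev evalPoint (F : opOpPoint ⟶ C) : C.unop.unop := F.unop.unop.toFunctor.obj ⟨⟨⟩⟩

/-- The functor from the terminal category picking an object. -/
abbrev point (c : C.unop.unop) : opOpPoint ⟶ C :=
  Quiver.Hom.op (Quiver.Hom.op ((Functor.const (Discrete PUnit.{u + 1})).obj c).toCatHom)

/-- The `2`-cell between functors from the terminal category given by a morphism. -/
def pointHom {F G : opOpPoint ⟶ C} (f : evalPoint F ⟶ evalPoint G) : F ⟶ G :=
  ⟨⟨⟨Discrete.natTrans (fun _ => f)⟩⟩⟩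

/-- The component of a `2`-cell between functors from the terminal category. -/
abbrev evalPointHom {F G : opOpPoint ⟶ C} (η : F ⟶ G) : evalPoint F ⟶ evalPoint G :=
  η.unop2.unop2.toNatTrans.app ⟨⟨⟩⟩

theorem opOpPoint_hom_ext {F G : opOpPoint ⟶ C} {η θ : F ⟶ G}
    (h : evalPointHom η = evalPointHom θ) : η = θ :=
  congrArg (fun t => (⟨⟨t⟩⟩ : F ⟶ G))
    (Cat.Hom₂.ext (NatTrans.ext (funext fun ⟨⟨⟩⟩ => h)))

/-- The invertible `2`-cell given by an isomorphism. -/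
def pointIso {F G : opOpPoint ⟶ C} (f : evalPoint F ≅ evalPoint G) : F ≅ G where
  hom := pointHom f.hom
  inv := pointHom f.inv
  hom_inv_id := opOpPoint_hom_ext f.hom_inv_id
  inv_hom_id := opOpPoint_hom_ext f.inv_hom_id

/-- The component of an invertible `2`-cell. -/
def evalPointIso {F G : opOpPoint ⟶ C} (e : F ≅ G) : evalPoint F ≅ evalPoint G where
  hom := evalPointHom e.hom
  inv := evalPointHom e.inv
  hom_inv_id := congrArg evalPointHom e.hom_inv_id
  inv_hom_id := congrArg evalPointHom e.inv_hom_id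

end CategoryTheory.Cat

open Cat

/-- At the terminal category, essential surjectivity of the comparison functor gives the objects and
fullness gives the morphisms. -/
theorem IsBipushout.isWeakPseudopullback {A B C D : Cat.{u, u}ᵒᵖ} {i : A ⟶ B} {j : A ⟶ C}
    {h : B ⟶ D} {k : C ⟶ D} {θ : j ≫ k ≅ i ≫ h} (hθ : IsBipushout θ) :
    Functor.IsWeakPseudopullback (p := i.unop.toFunctor) (q := j.unop.toFunctor)
      (h := h.unop.toFunctor) (k := k.unop.toFunctor) (Cat.Hom.toNatIso θ.unop2) where
  exists_obj x y e := by
    have := hθ opOpPoint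
    let Z : CategoricalPullback (postcomp opOpPoint j.op) (postcomp opOpPoint i.op) :=
      { fst := point (C := op C) y
        snd := point (C := op B) x
        -- The bipullback has `j` as its first leg, so its isomorphism runs from the image of `y` to
        -- that of `x`.
        iso := pointIso e.symm }
    let z := (bipullbackFunctor (f := j.op) (g := i.op) (s := k.op) (t := h.op) θ.op2
      opOpPoint).objPreimage Z
    let ez : (bipullbackFunctor (f := j.op) (g := i.op) (s := k.op) (t := h.op) θ.op2
      opOpPoint).obj z ≅ Z := Functor.objObjPreimageIso _ Z
    refine ⟨evalPoint z, evalPointIso ((CategoricalPullback.π₂ _ _).mapIso ez),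
      evalPointIso ((CategoricalPullback.π₁ _ _).mapIso ez), ?_⟩
    have hw := congrArg evalPointHom ez.hom.w
    change j.unop.toFunctor.map _ ≫ e.inv = (𝟙 _ ≫ θ.hom.unop2.toNatTrans.app (evalPoint z) ≫
      𝟙 _) ≫ i.unop.toFunctor.map _ at hw
    rw [Iso.comp_inv_eq, Category.id_comp, Category.comp_id, Category.assoc] at hw
    exact hw
  exists_hom w w' f g hfg := by
    have := hθ opOpPoint
    let φ : (bipullbackFunctor (f := j.op) (g := i.op) (s := k.op) (t := h.op) θ.op2
        opOpPoint).obj (point (C := op D) w) ⟶ (bipullbackFunctor (f := j.op) (g := i.op)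
          (s := k.op) (t := h.op) θ.op2 opOpPoint).obj (point (C := op D) w') :=
      { fst := pointHom g
        snd := pointHom f
        w := opOpPoint_hom_ext (by
          change j.unop.toFunctor.map g ≫ 𝟙 _ ≫ θ.hom.unop2.toNatTrans.app w' ≫ 𝟙 _ =
            (𝟙 _ ≫ θ.hom.unop2.toNatTrans.app w ≫ 𝟙 _) ≫ i.unop.toFunctor.map f
          rw [Category.id_comp, Category.comp_id, Category.id_comp, Category.comp_id]
          exact hfg) }
    have hm := Functor.map_preimage _ φ
    exact ⟨evalPointHom (Functor.preimage _ φ),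
      congrArg (fun t => evalPointHom (CategoricalPullback.Hom.snd t)) hm,
      congrArg (fun t => evalPointHom (CategoricalPullback.Hom.fst t)) hm⟩

theorem Slice.isWeakComma {A B C : Cat.{u, u}ᵒᵖᵒᵖ} {f : A ⟶ C} {g : B ⟶ C} (S : Slice f g) :
    Functor.IsWeakComma (F := f.unop.unop.toFunctor) (G := g.unop.unop.toFunctor)
      (s := S.s.unop.unop.toFunctor) (t := S.t.unop.unop.toFunctor)
      S.lam.unop2.unop2.toNatTrans where
  exists_obj a b φ := by
    have := S.isEquivalence opOpPoint
    let Z : Comma (postcomp opOpPoint f) (postcomp opOpPoint g) :=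
      { left := point a
        right := point b
        hom := pointHom φ }
    let z := (sliceFunctor S.lam opOpPoint).objPreimage Z
    let ez : (sliceFunctor S.lam opOpPoint).obj z ≅ Z := Functor.objObjPreimageIso _ Z
    refine ⟨evalPoint z, evalPointIso ((Comma.fst _ _).mapIso ez),
      evalPointIso ((Comma.snd _ _).mapIso ez), ?_⟩
    have hw := congrArg evalPointHom ez.hom.w
    change f.unop.unop.toFunctor.map _ ≫ φ =
      (𝟙 _ ≫ S.lam.unop2.unop2.toNatTrans.app (evalPoint z) ≫ 𝟙 _) ≫
        g.unop.unop.toFunctor.map _ at hw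
    rw [Category.id_comp, Category.comp_id] at hw
    exact hw
  exists_hom z z' m n hmn := by
    have := S.isEquivalence opOpPoint
    let φ : (sliceFunctor S.lam opOpPoint).obj (point z) ⟶
        (sliceFunctor S.lam opOpPoint).obj (point z') :=
      { left := pointHom m
        right := pointHom n
        w := opOpPoint_hom_ext (by
          change f.unop.unop.toFunctor.map m ≫ 𝟙 _ ≫
              S.lam.unop2.unop2.toNatTrans.app z' ≫ 𝟙 _ =
            (𝟙 _ ≫ S.lam.unop2.unop2.toNatTrans.app z ≫ 𝟙 _) ≫ g.unop.unop.toFunctor.map n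
          rw [Category.id_comp, Category.comp_id, Category.id_comp, Category.comp_id]
          exact hmn) }
    have hm := Functor.map_preimage _ φ
    exact ⟨evalPointHom (Functor.preimage _ φ),
      congrArg (fun t => evalPointHom (CommaMorphism.left t)) hm,
      congrArg (fun t => evalPointHom (CommaMorphism.right t)) hm⟩

theorem CategoryTheory.Bicategory.Adjunction.whiskerRight_unit_comp {K : Type u}
    [Bicategory.{w, v} K] {a b : K} {l : a ⟶ b} {r : b ⟶ a} (adj : l ⊣ r) :
    adj.unit ▷ l ≫ (α_ l r l).hom ≫ l ◁ adj.counit = (λ_ l).hom ≫ (ρ_ l).inv := by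
  rw [← adj.left_triangle]; bicategory

/-- A natural isomorphism from an invertible `2`-cell of `Catᵒᵖᵒᵖ`. -/
abbrev natIsoOfOpOp {A B : Cat.{u, u}ᵒᵖᵒᵖ} {f g : A ⟶ B} (e : f ≅ g) :
    f.unop.unop.toFunctor ≅ g.unop.unop.toFunctor :=
  Cat.Hom.toNatIso e.unop2.unop2

/-- The slices in the definition are arbitrary ones, so only their weak comma property is used; the
remaining data are evaluated componentwise. -/
theorem IsSliceFibration.hasWeakCartesianLifts {E A : Cat.{u, u}ᵒᵖᵒᵖ} {p : E ⟶ A}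
    (hp : IsSliceFibration p) : p.unop.unop.toFunctor.HasWeakCartesianLifts := by
  obtain ⟨S₀, S₁, P, σ, τ, hστ, r, adj, hadj⟩ := hp
  refine Functor.hasWeakCartesianLifts_of_adjunction S₀.isWeakComma S₁.isWeakComma
    (natIsoOfOpOp σ) (natIsoOfOpOp τ) (fun z => ?_)
    (fun z => adj.unit.unop2.unop2.toNatTrans.app z) (natIsoOfOpOp (asIso adj.counit))
    (fun z => ?_)
  · have h := congrArg (fun t => t.unop2.unop2.toNatTrans.app z) hστ
    change σ.hom.unop2.unop2.toNatTrans.app z ≫ (𝟙 _ ≫ S₁.lam.unop2.unop2.toNatTrans.app _) ≫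
      𝟙 _ ≫ p.unop.unop.toFunctor.map (τ.hom.unop2.unop2.toNatTrans.app z) =
      p.unop.unop.toFunctor.map (𝟙 _ ≫ S₀.lam.unop2.unop2.toNatTrans.app z ≫ 𝟙 _) at h
    rw [Category.id_comp, Category.id_comp, Category.id_comp] at h
    exact h.trans (congrArg (fun t => p.unop.unop.toFunctor.map t)
      (Category.comp_id (S₀.lam.unop2.unop2.toNatTrans.app z)))
  · have h := congrArg (fun t => t.unop2.unop2.toNatTrans.app z) adj.whiskerRight_unit_comp
    change P.unop.unop.toFunctor.map (adj.unit.unop2.unop2.toNatTrans.app z) ≫ 𝟙 _ ≫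
      adj.counit.unop2.unop2.toNatTrans.app _ = 𝟙 _ ≫ 𝟙 _ at h
    rw [Category.id_comp, Category.comp_id] at h
    exact h

/-! ### Comma categories provide slices, so the Yoneda clause for fibrations is void here. -/

section

variable {C : Type u} [Category.{v} C]

theorem CategoryTheory.square_of_id_comp {a b c d : C} {x : a ⟶ b} {y : b ⟶ d} {z : a ⟶ c}
    {w : c ⟶ d} (h : x ≫ 𝟙 b ≫ y ≫ 𝟙 d = (𝟙 a ≫ z ≫ 𝟙 c) ≫ w) : x ≫ y = z ≫ w := by
  simpa using h

theorem CategoryTheory.map_id_square {A : Type u₁} {B : Type u₂} [Category.{v₁} A]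
    [Category.{v₂} B] (F : A ⥤ C) (G : B ⥤ C) {a : A} {b : B} (x : F.obj a ⟶ G.obj b) :
    F.map (𝟙 a) ≫ x = (𝟙 (F.obj a) ≫ x ≫ 𝟙 (G.obj b)) ≫ G.map (𝟙 b) := by
  simp

end

/-- The comma category as a slice in `Catᵒᵖᵒᵖ`. -/
def Slice.ofComma {A B C : Cat.{u, u}ᵒᵖᵒᵖ} (f : A ⟶ C) (g : B ⟶ C) : Slice f g where
  pt := op (op (Cat.of (Comma f.unop.unop.toFunctor g.unop.unop.toFunctor)))
  s := Quiver.Hom.op (Quiver.Hom.op (Comma.fst _ _).toCatHom)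
  t := Quiver.Hom.op (Quiver.Hom.op (Comma.snd _ _).toCatHom)
  lam := ⟨⟨⟨Comma.natTrans _ _⟩⟩⟩
  isEquivalence X :=
    { faithful := ⟨fun {F G η θ} h => by
        have h₁ (x) := congrArg (fun (t : (sliceFunctor _ X).obj F ⟶ (sliceFunctor _ X).obj G) =>
          t.left.unop2.unop2.toNatTrans.app x) h
        have h₂ (x) := congrArg (fun (t : (sliceFunctor _ X).obj F ⟶ (sliceFunctor _ X).obj G) =>
          t.right.unop2.unop2.toNatTrans.app x) h
        exact congrArg (fun t => (⟨⟨t⟩⟩ : F ⟶ G))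
          (Cat.Hom₂.ext (NatTrans.ext (funext fun x => CommaMorphism.ext (h₁ x) (h₂ x))))⟩
      full := ⟨fun {F G} φ => by
        have hw (x) := congrArg (fun t => t.unop2.unop2.toNatTrans.app x) φ.w
        change ∀ x, f.unop.unop.toFunctor.map (φ.left.unop2.unop2.toNatTrans.app x) ≫ 𝟙 _ ≫
            (G.unop.unop.toFunctor.obj x).hom ≫ 𝟙 _ =
          (𝟙 _ ≫ (F.unop.unop.toFunctor.obj x).hom ≫ 𝟙 _) ≫
            g.unop.unop.toFunctor.map (φ.right.unop2.unop2.toNatTrans.app x) at hw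
        refine ⟨⟨⟨⟨
          { app := fun x =>
              { left := φ.left.unop2.unop2.toNatTrans.app x
                right := φ.right.unop2.unop2.toNatTrans.app x
                w := ?_ }
            naturality := fun x y m => ?_ }⟩⟩⟩, rfl⟩
        · exact square_of_id_comp (hw x)
        · exact CommaMorphism.ext (φ.left.unop2.unop2.toNatTrans.naturality m)
            (φ.right.unop2.unop2.toNatTrans.naturality m)⟩
      essSurj := ⟨fun Z => by
        let F : X.unop.unop ⥤ Comma f.unop.unop.toFunctor g.unop.unop.toFunctor :=
          { obj := fun x =>
              { left := Z.left.unop.unop.toFunctor.obj x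
                right := Z.right.unop.unop.toFunctor.obj x
                hom := Z.hom.unop2.unop2.toNatTrans.app x }
            map := fun m =>
              { left := Z.left.unop.unop.toFunctor.map m
                right := Z.right.unop.unop.toFunctor.map m
                w := Z.hom.unop2.unop2.toNatTrans.naturality m }
            map_id := fun x => CommaMorphism.ext (Z.left.unop.unop.toFunctor.map_id x)
              (Z.right.unop.unop.toFunctor.map_id x)
            map_comp := fun m n => CommaMorphism.ext (Z.left.unop.unop.toFunctor.map_comp m n)
              (Z.right.unop.unop.toFunctor.map_comp m n) }
        -- The projections of `F` are those of `Z` on the nose, so identities give the comparison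
        -- isomorphism.
        refine ⟨Quiver.Hom.op (Quiver.Hom.op F.toCatHom),
          ⟨Comma.isoMk (Iso.refl Z.left) (Iso.refl Z.right) ?_⟩⟩
        refine congrArg (fun t => (⟨⟨t⟩⟩ : (postcomp X f).obj Z.left ⟶
          (postcomp X g).obj Z.right)) (Cat.Hom₂.ext (NatTrans.ext (funext fun x => ?_)))
        change f.unop.unop.toFunctor.map (𝟙 _) ≫ Z.hom.unop2.unop2.toNatTrans.app x =
          (𝟙 _ ≫ Z.hom.unop2.unop2.toNatTrans.app x ≫ 𝟙 _) ≫ g.unop.unop.toFunctor.map (𝟙 _)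
        exact map_id_square f.unop.unop.toFunctor g.unop.unop.toFunctor
          (Z.hom.unop2.unop2.toNatTrans.app x)⟩ }

theorem mainTheorem8 : IsHomodular SetMod.upperStar.{u} where
  isLeftAdjoint i _ := SetMod.isLeftAdjoint_upperStar_map i
  isIso_mate {A B C D i j h k} θ hθ hi _ := by
    -- The Yoneda alternative requires a missing slice, which `Slice.ofComma` excludes.
    have hi' : IsSliceFibration i.op :=
      hi.resolve_right fun hn => hn.1 ⟨⟨Slice.ofComma _ _⟩, ⟨Slice.ofComma _ _⟩⟩
    refine ⟨SetMod.isLeftAdjoint_upperStar_map k, fun ri adji rk adjk => ?_⟩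
    have := SetMod.isIso_squareMate θ hi'.hasWeakCartesianLifts hθ.isWeakPseudopullback
    exact Bicategory.Adjunction.isIso_mateEquiv_of_isIso
      (SetMod.upperAdjLower (B := ⟨B.unop⟩) (A := ⟨A.unop⟩) i.unop.toFunctor) adji
      (SetMod.upperAdjLower (B := ⟨D.unop⟩) (A := ⟨C.unop⟩) k.unop.toFunctor) adjk
      (mapSquare SetMod.upperStar θ.hom)
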